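/- For polynomials $\mathfrak p_1,\dots,\mathfrak p_l\in\mathbb R[x_1,\dots,x_d]$ let $\mathcal P(\mathfrak p_1,\dots,\mathfrak p_l)=\{x\in\mathbb R^d:\mathfrak p_1(x)\ge 0,\dots,\mathfrak p_l(x)\ge 0\}$, and for a $d$-dimensional polyhedron $P\subset\mathbb R^d$ let $m_{\mathcal P}(P)$ be the smallest $l$ for which there are $\mathfrak p_1,\dots,\mathfrak p_l\in\mathbb R[x_1,\dots,x_d]$ with $P=\mathcal P(\mathfrak p_1,\dots,\mathfrak p_l)$. A $k$-polytope is a nonempty bounded intersection of finitely many closed halfspaces whose affine hull has dimension $k$. A $d$-polytope $P\subset\mathbb R^d$ is called a $d$-pyramid (respectively a $d$-prism) if there are a $(d-1)$-polytope $Q\subset\mathbb R^d$ and a point $v\in\mathbb R^d$ with $P=\mathrm{conv}(Q\cup\{v\})$ (respectively $P=Q+\mathrm{conv}\{0,v\}=\{q+\lambda v: q\in Q,\ 0\le\lambda\le 1\}$). **Corollary 2.4.** Let $P\subset\mathbb R^3$ be a 3-dimensional prism or pyramid. Then $m_{\mathcal P}(P)=3$. -/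

import Mathlib

open scoped Pointwise

/-- `P(p₁, …, p_l)`: the closed semi-algebraic set of all points of `ℝᵈ` at which each of the
polynomials `p₁, …, p_l` is nonnegative. -/
def semialgSet {d l : ℕ} (p : Fin l → MvPolynomial (Fin d) ℝ) :
    Set (EuclideanSpace ℝ (Fin d)) :=
  {x | ∀ j, 0 ≤ MvPolynomial.eval (fun i => x i) (p j)}

/-- A representation of `P ⊆ ℝᵈ` by the `l` polynomial inequalities `p_j ≥ 0`. -/
def IsPolyRep {d l : ℕ} (P : Set (EuclideanSpace ℝ (Fin d)))
    (p : Fin l → MvPolynomial (Fin d) ℝ) : Prop :=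
  P = semialgSet p

/-- `m_P(P)`: the minimal number of polynomials in a representation of `P ⊆ ℝᵈ` by polynomial
inequalities in `d` variables; it is used for full-dimensional `P`. (A set with no such
representation gets the value `0`, so an equation `minPolyNum P = n` with `n ≠ 0` also says that
a representation exists.) -/
noncomputable def minPolyNum {d : ℕ} (P : Set (EuclideanSpace ℝ (Fin d))) : ℕ :=
  sInf {l : ℕ | ∃ p : Fin l → MvPolynomial (Fin d) ℝ, IsPolyRep P p}

/-- A polyhedron in `ℝᵈ`: the intersection of finitely many closed halfspaces. -/
def IsPolyhedron {d : ℕ} (P : Set (EuclideanSpace ℝ (Fin d))) : Prop :=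
  ∃ (m : ℕ) (a : Fin m → EuclideanSpace ℝ (Fin d)) (b : Fin m → ℝ),
    P = {x | ∀ i, inner ℝ (a i) x ≤ b i}

/-- A `k`-polytope in `ℝᵈ`: a nonempty bounded polyhedron whose affine hull has dimension `k`. -/
def IsPolytopeOfDim {d : ℕ} (k : ℕ) (P : Set (EuclideanSpace ℝ (Fin d))) : Prop :=
  IsPolyhedron P ∧ Bornology.IsBounded P ∧ P.Nonempty ∧
    Module.finrank ℝ (affineSpan ℝ P).direction = k

/-- A `d`-pyramid in `ℝᵈ`: a `d`-polytope `P = conv {Q, v}` whose basis `Q` is a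
`(d-1)`-polytope. -/
def IsPyramid {d : ℕ} (P : Set (EuclideanSpace ℝ (Fin d))) : Prop :=
  IsPolytopeOfDim d P ∧
    ∃ (k : ℕ) (Q : Set (EuclideanSpace ℝ (Fin d))) (v : EuclideanSpace ℝ (Fin d)),
      k + 1 = d ∧ IsPolytopeOfDim k Q ∧ P = convexHull ℝ (Q ∪ {v})

/-- A `d`-prism in `ℝᵈ`: a `d`-polytope `P = Q + conv {0, v}` (Minkowski sum) whose basis `Q`
is a `(d-1)`-polytope. -/
def IsPrism {d : ℕ} (P : Set (EuclideanSpace ℝ (Fin d))) : Prop :=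
  IsPolytopeOfDim d P ∧
    ∃ (k : ℕ) (Q : Set (EuclideanSpace ℝ (Fin d))) (v : EuclideanSpace ℝ (Fin d)),
      k + 1 = d ∧ IsPolytopeOfDim k Q ∧ P = Q + convexHull ℝ {0, v}

/-! Lower bound: the base plane `s = 0` supports `P` and cuts it in a polygon. Suppose two
polynomials describe `P`. If one vanishes identically on the plane, the other alone describes the
polygon. This is impossible (`polygon_ne_nonneg_set`): it would vanish along an edge, hence on the
whole line of that edge, and the bounded polygon would contain a line. Otherwise both are positive
at some interior point of the base, hence also slightly below the plane, outside `P`.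

Upper bound: a polygon needs only two inequalities (`exists_two_inequalities`). One is the product
of its edge forms; the other is `F ≤ 1`, with `F` a convex sum of even powers of affine forms, equal
to `1` at every vertex. Outside the polygon a nonnegative product leaves two edge forms nonpositive;
some vertex then lies strictly between the point and the polygon, and strict convexity forces `F >
1`. For a prism the third inequality is `s (1 - s) ≥ 0`. For a pyramid the planar inequalities are
homogenized with `t = 1 - s`, and the third one removes `t < 0` and `t > 1`
(`mem_cone_polygon_iff`). -/

open Filter Topology

/-! ### Affine forms and irredundant descriptions of polygons -/

/-- The linear form on `ℝ² × ℝ` with coefficients `c`. -/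
def homForm (c : ℝ × ℝ × ℝ) (y : ℝ × ℝ) (t : ℝ) : ℝ :=
  c.1 * y.1 + c.2.1 * y.2 + c.2.2 * t

/-- The planar polyhedron cut out by the affine functions with coefficients in `S`. -/
def polygon (S : Finset (ℝ × ℝ × ℝ)) : Set (ℝ × ℝ) :=
  {y | ∀ c ∈ S, 0 ≤ homForm c y 1}

theorem homForm_combo (c : ℝ × ℝ × ℝ) (x y : ℝ × ℝ) {a b : ℝ} (h : a + b = 1) :
    homForm c (a • x + b • y) 1 = a * homForm c x 1 + b * homForm c y 1 := by
  obtain rfl : b = 1 - a := by linarith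
  simp only [homForm, Prod.fst_add, Prod.snd_add, Prod.smul_fst, Prod.smul_snd, smul_eq_mul]
  ring

theorem homForm_smul (c : ℝ × ℝ × ℝ) (y : ℝ × ℝ) (t r : ℝ) :
    homForm c (r • y) (r * t) = r * homForm c y t := by
  simp only [homForm, Prod.smul_fst, Prod.smul_snd, smul_eq_mul]
  ring

theorem homForm_sum {ι : Type*} (s : Finset ι) (f : ι → ℝ × ℝ × ℝ) (y : ℝ × ℝ) (t : ℝ) :
    homForm (∑ i ∈ s, f i) y t = ∑ i ∈ s, homForm (f i) y t := by
  simp only [homForm, Prod.fst_sum, Prod.snd_sum, Finset.sum_mul, ← Finset.sum_add_distrib]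

theorem continuous_homForm (c : ℝ × ℝ × ℝ) : Continuous fun y => homForm c y 1 := by
  unfold homForm; fun_prop

theorem isClosed_polygon (S : Finset (ℝ × ℝ × ℝ)) : IsClosed (polygon S) := by
  have : polygon S = ⋂ c ∈ S, {y | 0 ≤ homForm c y 1} := by ext; simp [polygon]
  rw [this]
  exact isClosed_biInter fun c _ => isClosed_le continuous_const (continuous_homForm c)

theorem convex_polygon (S : Finset (ℝ × ℝ × ℝ)) : Convex ℝ (polygon S) := by
  intro x hx y hy a b ha hb hab c hc
  rw [homForm_combo c x y hab]
  have := hx c hc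
  have := hy c hc
  positivity

/-- Every form of `S` has a point on its line at which all the other forms are positive. -/
def IsIrredundant (S : Finset (ℝ × ℝ × ℝ)) : Prop :=
  ∀ c ∈ S, (c.1 ≠ 0 ∨ c.2.1 ≠ 0) ∧
    ∃ y, homForm c y 1 = 0 ∧ ∀ c' ∈ S, c' ≠ c → 0 < homForm c' y 1

/-- In a minimal subfamily with the same polygon, each form `c` is negative at some point where all
the others are nonnegative. The segment from there to an interior point of the polygon crosses the
line of `c` where the others are positive. The unit triangle supplies the interior point. -/
theorem exists_irredundant (S : Finset (ℝ × ℝ × ℝ)) (h0 : (0, 0) ∈ polygon S)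
    (h1 : (1, 0) ∈ polygon S) (h2 : (0, 1) ∈ polygon S) :
    ∃ T, polygon T = polygon S ∧ IsIrredundant T := by
  classical
  obtain ⟨T, hT⟩ := (S.powerset.filter fun T => polygon T = polygon S).exists_minimal
    ⟨S, by simp⟩
  have hTS : polygon T = polygon S := (Finset.mem_filter.1 hT.1).2
  have hTsub : T ⊆ S := Finset.mem_powerset.1 (Finset.mem_filter.1 hT.1).1
  have key : ∀ c ∈ T, ∃ z, homForm c z 1 < 0 ∧ ∀ c' ∈ T, c' ≠ c → 0 ≤ homForm c' z 1 := by
    intro c hc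
    by_contra! hcon
    have hE : polygon (T.erase c) = polygon S := by
      rw [← hTS]
      ext z
      refine ⟨fun hz c' hc' => ?_, fun hz c' hc' => hz c' (Finset.mem_of_mem_erase hc')⟩
      by_cases hcc : c' = c
      · subst hcc
        by_contra! hneg
        obtain ⟨d, hd, hdc, hdn⟩ := hcon z hneg
        exact absurd (hz d (Finset.mem_erase.2 ⟨hdc, hd⟩)) (not_le.2 hdn)
      · exact hz c' (Finset.mem_erase.2 ⟨hcc, hc'⟩)
    have := hT.2 (Finset.mem_filter.2 ⟨Finset.mem_powerset.2
      ((Finset.erase_subset c T).trans hTsub), hE⟩) (Finset.erase_subset c T)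
    exact Finset.notMem_erase c T (this hc)
  have hpos : ∀ c ∈ T, 0 < homForm c (1 / 3, 1 / 3) 1 := by
    intro c hc
    rw [← hTS] at h0 h1 h2
    have e0 := h0 c hc
    have e1 := h1 c hc
    have e2 := h2 c hc
    obtain ⟨z, hz, -⟩ := key c hc
    simp only [homForm] at e0 e1 e2 hz ⊢
    -- A form nonnegative at the three corners but not positive at their centroid is zero, so it is
    -- never negative.
    by_contra! hle
    have a0 : c.2.2 = 0 := by linarith
    have a1 : c.1 = 0 := by linarith
    have a2 : c.2.1 = 0 := by linarith
    simp [a0, a1, a2] at hz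
  refine ⟨T, hTS, fun c hc => ?_⟩
  obtain ⟨z, hz, hz'⟩ := key c hc
  have hp := hpos c hc
  refine ⟨?_, ?_⟩
  · by_contra! hcon
    simp only [homForm, hcon.1, hcon.2] at hz hp
    linarith
  · set A := homForm c (1 / 3, 1 / 3) 1
    set B := homForm c z 1
    have hAB : 0 < A - B := by linarith
    have hsum : -B / (A - B) + A / (A - B) = 1 := by field_simp; ring
    refine ⟨(-B / (A - B)) • (1 / 3, 1 / 3) + (A / (A - B)) • z, ?_, fun c' hc' hne => ?_⟩
    · rw [homForm_combo _ _ _ hsum]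
      change -B / (A - B) * A + A / (A - B) * B = 0
      ring
    · rw [homForm_combo _ _ _ hsum]
      have := hpos c' hc'
      have := hz' c' hc' hne
      have hB : 0 < -B := by linarith
      positivity

/-- A point of `polygon S` can be moved a little in every direction that keeps the forms vanishing
there nonnegative. -/
theorem eventually_mem_polygon {S : Finset (ℝ × ℝ × ℝ)} {y : ℝ × ℝ} (γ : ℝ → ℝ × ℝ)
    (hγ : Continuous γ) (h0 : γ 0 = y)
    (h : ∀ c ∈ S, 0 < homForm c y 1 ∨ ∀ r, 0 ≤ homForm c (γ r) 1) :
    ∀ᶠ r in 𝓝 (0 : ℝ), γ r ∈ polygon S := by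
  change ∀ᶠ r in 𝓝 (0 : ℝ), ∀ c ∈ S, 0 ≤ homForm c (γ r) 1
  rw [Filter.eventually_all_finset]
  intro c hc
  rcases h c hc with h | h
  · have : ∀ᶠ r in 𝓝 (0 : ℝ), 0 < homForm c (γ r) 1 :=
      ((continuous_homForm c).comp hγ).continuousAt.eventually_const_lt (by simpa [h0] using h)
    exact this.mono fun _ h => h.le
  · exact Eventually.of_forall h

theorem isCompact_polygon {S : Finset (ℝ × ℝ × ℝ)} {R : ℝ}
    (hR : ∀ y ∈ polygon S, |y.1| ≤ R ∧ |y.2| ≤ R) : IsCompact (polygon S) := by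
  refine Metric.isCompact_of_isClosed_isBounded (isClosed_polygon S)
    ((Metric.isBounded_closedBall (x := 0) (r := R)).subset ?_)
  intro y hy
  rw [mem_closedBall_zero_iff]
  exact max_le (hR y hy).1 (hR y hy).2

/-! ### One inequality is not enough for a polygon -/

/-- A polygon is not the nonnegativity set of a single polynomial. -/
theorem polygon_ne_nonneg_set {S : Finset (ℝ × ℝ × ℝ)} {R : ℝ}
    (hR : ∀ y ∈ polygon S, |y.1| ≤ R ∧ |y.2| ≤ R) (h0 : (0, 0) ∈ polygon S)
    (h1 : (1, 0) ∈ polygon S) (h2 : (0, 1) ∈ polygon S) (q : MvPolynomial (Fin 2) ℝ)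
    (hq : ∀ y : ℝ × ℝ, y ∈ polygon S ↔ 0 ≤ MvPolynomial.eval ![y.1, y.2] q) : False := by
  obtain ⟨T, hTS, hT⟩ := exists_irredundant S h0 h1 h2
  rw [← hTS] at hR hq h0
  rcases T.eq_empty_or_nonempty with rfl | ⟨c, hc⟩
  · have h : (|R| + 1, (0 : ℝ)) ∈ polygon ∅ := by simp [polygon]
    have := (le_abs_self _).trans (hR _ h).1
    have := le_abs_self R
    simp only at *
    linarith
  obtain ⟨hne, y, hy, hy'⟩ := hT c hc
  set N := c.1 ^ 2 + c.2.1 ^ 2 with hN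
  have hNpos : 0 < N := by
    rcases hne with h | h <;> positivity
  set line : ℝ → ℝ × ℝ := fun r => (y.1 - r * c.2.1, y.2 + r * c.1) with hline
  have hlc : ∀ r, homForm c (line r) 1 = 0 := by
    intro r
    rw [← hy]; simp only [homForm, hline]; ring
  have hev : ∀ᶠ r in 𝓝 (0 : ℝ), line r ∈ polygon T := by
    refine eventually_mem_polygon (y := y) line (by fun_prop) (by simp [hline]) fun d hd => ?_
    by_cases hdc : d = c
    · exact Or.inr fun r => by rw [hdc, hlc]
    · exact Or.inl (hy' d hd hdc)
  -- Just beyond the line the form `c` is negative, so `q` is negative there; let `ε` tend to `0`.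
  have hle : ∀ r, MvPolynomial.eval ![(line r).1, (line r).2] q ≤ 0 := by
    intro r
    have hcont : Continuous fun ε : ℝ => MvPolynomial.eval
        ![(line r).1 - ε * c.1, (line r).2 - ε * c.2.1] q := by
      refine q.continuous_eval.comp (continuous_pi fun i => ?_)
      fin_cases i <;> simp <;> fun_prop
    have ht : Tendsto (fun ε : ℝ => MvPolynomial.eval
        ![(line r).1 - ε * c.1, (line r).2 - ε * c.2.1] q) (𝓝[>] 0)
        (𝓝 (MvPolynomial.eval ![(line r).1, (line r).2] q)) := by
      have := (hcont.tendsto 0).mono_left (nhdsWithin_le_nhds (s := Set.Ioi 0))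
      simpa using this
    refine le_of_tendsto ht (eventually_mem_nhdsWithin.mono fun ε hε => ?_)
    by_contra! hpos
    have := (hq ((line r).1 - ε * c.1, (line r).2 - ε * c.2.1)).2 hpos.le c hc
    have h3 := hlc r
    simp only [homForm] at this h3
    have : 0 < ε * N := mul_pos hε hNpos
    nlinarith
  set u : Polynomial ℝ := MvPolynomial.aeval
    ![Polynomial.C y.1 - Polynomial.X * Polynomial.C c.2.1,
      Polynomial.C y.2 + Polynomial.X * Polynomial.C c.1] q with hu
  have hueval : ∀ r, u.eval r = MvPolynomial.eval ![(line r).1, (line r).2] q := by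
    intro r
    rw [hu, ← Polynomial.coe_evalRingHom, MvPolynomial.aeval_def, MvPolynomial.hom_eval₂,
      ← MvPolynomial.eval₂_id]
    congr 1
    · ext; simp
    · funext i; fin_cases i <;> simp [hline] <;> ring
  -- On the edge itself `q` is also nonnegative, so the one-variable polynomial `u` has infinitely
  -- many roots.
  have hu0 : u = 0 := by
    refine Polynomial.eq_zero_of_infinite_isRoot u ?_
    obtain ⟨ε, hε, hball⟩ := Metric.eventually_nhds_iff.1 hev
    refine (Set.Ioo_infinite (neg_lt_self hε)).mono fun r hr => ?_
    have hr' : line r ∈ polygon T := hball (by simpa [abs_lt] using hr)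
    exact le_antisymm ((hueval r).trans_le (hle r)) (((hq _).1 hr').trans_eq (hueval r).symm)
  have hall : ∀ r, line r ∈ polygon T := fun r => by rw [hq, ← hueval, hu0]; simp
  have hR0 : 0 ≤ R := (abs_nonneg _).trans (hR _ h0).1
  have hrad := hR _ (hall 0)
  simp only [hline, zero_mul, sub_zero, add_zero] at hrad
  rcases hne with h | h
  · have := (hR _ (hall ((2 * R + 1) / c.1))).2
    simp only [hline, div_mul_cancel₀ _ h] at this
    have h5 := (abs_le.1 hrad.2).1
    have h6 := (abs_le.1 this).2
    linarith
  · have := (hR _ (hall ((2 * R + 1) / c.2.1))).1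
    simp only [hline, div_mul_cancel₀ _ h] at this
    have h5 := (abs_le.1 hrad.1).2
    have h6 := (abs_le.1 this).1
    linarith

/-! ### Vertices, and Bernig's theorem in the plane -/

/-- Forms active at `v` vanish along the line through `v` and `q`, so one can step from `v` a little
away from `q` inside the polygon; extremality of `v` then forces `q = v`. -/
theorem eq_of_extreme_of_active {S : Finset (ℝ × ℝ × ℝ)} {v q : ℝ × ℝ}
    (hv : v ∈ (polygon S).extremePoints ℝ) (hq : q ∈ polygon S)
    (h : ∀ c ∈ S, homForm c v 1 = 0 → homForm c q 1 = 0) : q = v := by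
  have hev : ∀ᶠ r in 𝓝 (0 : ℝ), (1 + r) • v + (-r) • q ∈ polygon S := by
    refine eventually_mem_polygon (y := v) (fun r => (1 + r) • v + (-r) • q) (by fun_prop)
      (by simp) fun c hc => ?_
    rcases (hv.1 c hc).eq_or_lt with h' | h'
    · refine Or.inr fun r => ?_
      rw [homForm_combo _ _ _ (by ring), ← h', h c hc h'.symm]
      simp
    · exact Or.inl h'
  obtain ⟨r, hr, hr0⟩ := ((hev.filter_mono nhdsWithin_le_nhds).and
    (eventually_mem_nhdsWithin (a := (0 : ℝ)) (s := Set.Ioi 0))).exists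
  have hr0 : 0 < r := hr0
  refine hv.2 hq hr ⟨r / (1 + r), 1 / (1 + r), by positivity, by positivity,
    by field_simp; ring, ?_⟩
  ext <;> simp <;> field_simp <;> ring

/-- A vertex is determined by its set of active forms. -/
theorem finite_extremePoints_polygon (S : Finset (ℝ × ℝ × ℝ)) :
    ((polygon S).extremePoints ℝ).Finite := by
  classical
  refine Set.Finite.of_finite_image (f := fun v => S.filter fun c => homForm c v 1 = 0)
    (S.powerset.finite_toSet.subset ?_) ?_
  · rintro _ ⟨v, -, rfl⟩
    exact Finset.mem_coe.2 (Finset.mem_powerset.2 (Finset.filter_subset _ S))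
  · intro v hv w hw hvw
    refine eq_of_extreme_of_active hw hv.1 fun c hc h => ?_
    have : c ∈ S.filter fun c => homForm c w 1 = 0 := Finset.mem_filter.2 ⟨hc, h⟩
    exact (Finset.mem_filter.1 (Finset.ext_iff.1 hvw c |>.2 this)).2

theorem polygon_subset_of_extremePoints_subset {S : Finset (ℝ × ℝ × ℝ)}
    (hS : IsCompact (polygon S)) {C : Set (ℝ × ℝ)} (hC : IsClosed C) (hCc : Convex ℝ C)
    (h : (polygon S).extremePoints ℝ ⊆ C) : polygon S ⊆ C := by
  rw [← closure_convexHull_extremePoints hS (convex_polygon S)]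
  exact closure_minimal (convexHull_min h hCc) hC

/-- Seen from a point beyond one side and not strictly inside another side, some vertex of the
polygon lies in front of another point of the polygon. -/
theorem exists_extremePoint_openSegment {S : Finset (ℝ × ℝ × ℝ)} (hS : IsIrredundant S)
    (hcomp : IsCompact (polygon S)) {x : ℝ × ℝ} {c₁ c₂ : ℝ × ℝ × ℝ} (h₁ : c₁ ∈ S) (h₂ : c₂ ∈ S)
    (hne : c₁ ≠ c₂) (hx₁ : homForm c₁ x 1 < 0) (hx₂ : homForm c₂ x 1 ≤ 0) :
    ∃ v ∈ (polygon S).extremePoints ℝ, ∃ q ∈ polygon S, q ≠ v ∧ v ∈ openSegment ℝ x q := by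
  obtain ⟨-, y₁, hy₁, hy₁'⟩ := hS c₁ h₁
  obtain ⟨-, y₂, hy₂, hy₂'⟩ := hS c₂ h₂
  have e₁ := hy₂' c₁ h₁ hne
  have e₂ := hy₁' c₂ h₂ hne.symm
  have hmem₁ : y₁ ∈ polygon S := fun c hc => by
    by_cases h : c = c₁
    · rw [h, hy₁]
    · exact (hy₁' c hc h).le
  have hmem₂ : y₂ ∈ polygon S := fun c hc => by
    by_cases h : c = c₂
    · rw [h, hy₂]
    · exact (hy₂' c hc h).le
  set D := (y₂.1 - y₁.1) * (x.2 - y₁.2) - (y₂.2 - y₁.2) * (x.1 - y₁.1) with hD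
  -- `D` is twice the signed area of the triangle `y₁ y₂ x`. If it vanished, the right side of `key`
  -- would be both zero and negative.
  have hD0 : D ≠ 0 := by
    intro h0
    have key : (c₁.1 * c₂.2.1 - c₁.2.1 * c₂.1) * D =
        (homForm c₁ y₂ 1 - homForm c₁ y₁ 1) * (homForm c₂ x 1 - homForm c₂ y₁ 1) -
        (homForm c₁ x 1 - homForm c₁ y₁ 1) * (homForm c₂ y₂ 1 - homForm c₂ y₁ 1) := by
      simp only [homForm, hD]; ring
    rw [h0, hy₁, hy₂] at key
    nlinarith [mul_pos e₁ e₂, mul_nonneg e₁.le (neg_nonneg.2 hx₂), mul_pos (neg_pos.2 hx₁) e₂]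
  -- `1 - α - β`, `α`, `β` are the barycentric coordinates in the triangle `y₁ y₂ x`.
  set α : ℝ × ℝ → ℝ := fun p =>
    ((p.1 - y₁.1) * (x.2 - y₁.2) - (p.2 - y₁.2) * (x.1 - y₁.1)) / D with hα
  set β : ℝ × ℝ → ℝ := fun p =>
    ((y₂.1 - y₁.1) * (p.2 - y₁.2) - (y₂.2 - y₁.2) * (p.1 - y₁.1)) / D with hβ
  have hform : ∀ c p, homForm c p 1 =
      (1 - α p - β p) * homForm c y₁ 1 + α p * homForm c y₂ 1 + β p * homForm c x 1 := by
    intro c p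
    simp only [homForm, hα, hβ]
    field_simp
    simp only [hD]
    ring
  -- The midpoint of `y₁ y₂` is interior, so the polygon extends beyond this chord towards `x`, and
  -- hence so does a vertex.
  obtain ⟨w, hw, hβw⟩ : ∃ w ∈ (polygon S).extremePoints ℝ, 0 < β w := by
    by_contra! hcon
    have hsub := polygon_subset_of_extremePoints_subset hcomp (C := {p | β p ≤ 0})
      (isClosed_le (by fun_prop) continuous_const) (by
        intro p hp r hr a b ha hb hab
        have hb' : β (a • p + b • r) = a * β p + b * β r := by
          obtain rfl : b = 1 - a := by linarith
          simp only [hβ, Prod.fst_add, Prod.snd_add, Prod.smul_fst, Prod.smul_snd, smul_eq_mul]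
          ring
        change β (a • p + b • r) ≤ 0
        rw [hb']
        exact add_nonpos (mul_nonpos_of_nonneg_of_nonpos ha hp)
          (mul_nonpos_of_nonneg_of_nonpos hb hr)) hcon
    have hev : ∀ᶠ r in 𝓝 (0 : ℝ),
        ((1 / 2 : ℝ) • y₁ + (1 / 2 : ℝ) • y₂) + r • (x - y₁) ∈ polygon S := by
      refine eventually_mem_polygon (y := (1 / 2 : ℝ) • y₁ + (1 / 2 : ℝ) • y₂)
        (fun r => ((1 / 2 : ℝ) • y₁ + (1 / 2 : ℝ) • y₂) + r • (x - y₁)) (by fun_prop) (by simp)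
        fun c hc => Or.inl ?_
      rw [homForm_combo _ _ _ (by norm_num)]
      by_cases h : c = c₁
      · have := hy₂' c hc (h ▸ hne)
        have := hmem₁ c hc
        positivity
      · have := hy₁' c hc h
        have := hmem₂ c hc
        positivity
    obtain ⟨r, hr, hr0⟩ := ((hev.filter_mono nhdsWithin_le_nhds).and
      (eventually_mem_nhdsWithin (a := (0 : ℝ)) (s := Set.Ioi 0))).exists
    have hr0 : 0 < r := hr0
    have hle : β _ ≤ 0 := hsub hr
    have : β (((1 / 2 : ℝ) • y₁ + (1 / 2 : ℝ) • y₂) + r • (x - y₁)) = r := by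
      simp only [hβ, Prod.fst_add, Prod.snd_add, Prod.smul_fst, Prod.smul_snd, smul_eq_mul,
        Prod.fst_sub, Prod.snd_sub]
      field_simp
      simp only [hD]
      ring
    linarith
  have i₁ := hform c₁ w ▸ hw.1 c₁ h₁
  have i₂ := hform c₂ w ▸ hw.1 c₂ h₂
  rw [hy₁] at i₁
  rw [hy₂] at i₂
  -- The two sides `c₁` and `c₂` confine `w` to the triangle, so the ray from `x` through `w` meets
  -- the chord `y₁ y₂`, which lies in the polygon.
  have hαw : 0 < α w := by
    by_contra! h
    nlinarith [mul_nonneg (neg_nonneg.2 h) e₁.le, mul_pos hβw (neg_pos.2 hx₁)]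
  have hsum : 0 ≤ 1 - α w - β w := by
    by_contra! h
    nlinarith [mul_pos (neg_pos.2 h) e₂, mul_nonneg hβw.le (neg_nonneg.2 hx₂)]
  have hβ1 : 0 < 1 - β w := by linarith
  have hcomb : (1 - α w - β w) / (1 - β w) + α w / (1 - β w) = 1 := by field_simp; ring
  have hz := convex_polygon S hmem₁ hmem₂ (div_nonneg hsum hβ1.le) (div_nonneg hαw.le hβ1.le) hcomb
  have hseg : β w • x + (1 - β w) • (((1 - α w - β w) / (1 - β w)) • y₁ +
      (α w / (1 - β w)) • y₂) = w := by
    have p1 := hform (1, 0, 0) w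
    have p2 := hform (0, 1, 0) w
    simp only [homForm] at p1 p2
    ext
    · simp only [Prod.fst_add, Prod.smul_fst, smul_eq_mul]
      field_simp
      linarith
    · simp only [Prod.snd_add, Prod.smul_snd, smul_eq_mul]
      field_simp
      linarith
  refine ⟨w, hw, _, hz, fun heq => ?_, β w, 1 - β w, hβw, hβ1, by ring, hseg⟩
  have hx : x = w := by
    rw [heq] at hseg
    have h3 : β w • (x - w) = 0 := by
      rw [← sub_eq_zero.2 hseg]
      generalize β w = b
      module
    exact sub_eq_zero.1 ((smul_eq_zero.1 h3).resolve_left hβw.ne')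
  exact absurd (hw.1 c₁ h₁) (not_le.2 (hx ▸ hx₁))

/-- As `k` grows the matrix of even powers tends to the identity, so the solution tends to the
all-ones vector and is eventually positive. Cramer's rule writes it through the adjugate, which
depends continuously on the matrix. -/
theorem exists_pos_mulVec_eq_one {ι : Type*} [Fintype ι] (a : ι → ι → ℝ)
    (hdiag : ∀ i, a i i = 1) (hoff : ∀ i j, i ≠ j → |a i j| < 1) :
    ∃ (k : ℕ) (lam : ι → ℝ), k ≠ 0 ∧ (∀ i, 0 < lam i) ∧
      ∀ i, ∑ j, lam j * a i j ^ (2 * k) = 1 := by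
  classical
  set A : ℕ → Matrix ι ι ℝ := fun k => Matrix.of fun i j => a i j ^ (2 * k) with hA
  have hA1 : Tendsto A atTop (𝓝 1) := by
    refine tendsto_pi_nhds.2 fun i => tendsto_pi_nhds.2 fun j => ?_
    by_cases hij : i = j
    · subst hij
      simp [hA, hdiag]
    · have h : Tendsto (fun k : ℕ => (a i j ^ 2) ^ k) atTop (𝓝 0) :=
        tendsto_pow_atTop_nhds_zero_of_lt_one (sq_nonneg _)
          ((sq_lt_one_iff_abs_lt_one _).2 (hoff i j hij))
      simpa [hA, Matrix.one_apply_ne hij, pow_mul] using h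
  have hdet : Tendsto (fun k => (A k).det) atTop (𝓝 1) := by
    have := ((continuous_id.matrix_det (n := ι) (R := ℝ)).tendsto 1).comp hA1
    simpa [Function.comp_def] using this
  have hadj : ∀ i, Tendsto (fun k => ((A k).adjugate.mulVec 1) i) atTop (𝓝 1) := by
    intro i
    have hc : Continuous fun M : Matrix ι ι ℝ => (M.adjugate.mulVec 1) i :=
      (continuous_apply i).comp (continuous_id.matrix_adjugate.matrix_mulVec continuous_const)
    have := (hc.tendsto 1).comp hA1
    simpa [Function.comp_def] using this
  obtain ⟨k, ⟨hk1, hk2⟩, hk0⟩ := (((hdet.eventually_const_lt one_pos).and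
    (eventually_all.2 fun i => (hadj i).eventually_const_lt one_pos)).and
    (eventually_ne_atTop 0)).exists
  refine ⟨k, fun j => ((A k).adjugate.mulVec 1) j / (A k).det, hk0,
    fun j => div_pos (hk2 j) hk1, fun i => ?_⟩
  have h : ((A k).mulVec ((A k).adjugate.mulVec 1)) i = (A k).det := by
    rw [Matrix.mulVec_mulVec, Matrix.mul_adjugate, Matrix.smul_mulVec, Matrix.one_mulVec]
    simp
  generalize (A k).adjugate.mulVec 1 = μ at h ⊢
  calc ∑ j, μ j / (A k).det * a i j ^ (2 * k)
      = ((A k).mulVec μ) i / (A k).det := by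
        rw [Matrix.mulVec, dotProduct, Finset.sum_div]
        refine Finset.sum_congr rfl fun j _ => ?_
        simp only [hA, Matrix.of_apply]
        ring
    _ = 1 := by rw [h, div_self hk1.ne']

/-- A convex even-power sum that is at most `1` on the polygon, with equality at the vertices. -/
theorem exists_sum_pow_le_one {S : Finset (ℝ × ℝ × ℝ)} (hcomp : IsCompact (polygon S)) :
    ∃ (n : ℕ) (h : Fin n → ℝ × ℝ × ℝ) (lam : Fin n → ℝ) (k : ℕ), k ≠ 0 ∧
      (∀ y ∈ polygon S, ∑ j, lam j * homForm (h j) y 1 ^ (2 * k) ≤ 1) ∧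
      ∀ v ∈ (polygon S).extremePoints ℝ, ∀ q ∈ polygon S, q ≠ v → ∀ x, v ∈ openSegment ℝ x q →
        1 < ∑ j, lam j * homForm (h j) x 1 ^ (2 * k) := by
  classical
  obtain ⟨n, v, hinj, hrange⟩ := (finite_extremePoints_polygon S).fin_param
  have hvmem : ∀ i, v i ∈ (polygon S).extremePoints ℝ := fun i => hrange ▸ Set.mem_range_self i
  -- The sum of the forms active at `v i` is nonnegative on the polygon and vanishes there only at
  -- `v i`.
  set σ : Fin n → ℝ × ℝ × ℝ := fun i => ∑ c ∈ S with homForm c (v i) 1 = 0, c with hσ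
  have hσv : ∀ i, homForm (σ i) (v i) 1 = 0 := fun i => by
    rw [hσ, homForm_sum]
    exact Finset.sum_eq_zero fun c hc => (Finset.mem_filter.1 hc).2
  have hσnn : ∀ i, ∀ q ∈ polygon S, 0 ≤ homForm (σ i) q 1 := fun i q hq => by
    rw [hσ, homForm_sum]
    exact Finset.sum_nonneg fun c hc => hq c (Finset.mem_filter.1 hc).1
  have hσpos : ∀ i, ∀ q ∈ polygon S, q ≠ v i → 0 < homForm (σ i) q 1 := by
    refine fun i q hq hne => (hσnn i q hq).lt_of_ne' fun h0 => hne ?_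
    refine eq_of_extreme_of_active (hvmem i) hq fun c hc hcv => ?_
    rw [hσ, homForm_sum, Finset.sum_eq_zero_iff_of_nonneg
      fun c hc => hq c (Finset.mem_filter.1 hc).1] at h0
    exact h0 c (Finset.mem_filter.2 ⟨hc, hcv⟩)
  set M := ∑ i, ∑ j, homForm (σ i) (v j) 1 with hM
  have hM0 : 0 ≤ M := Finset.sum_nonneg fun i _ => Finset.sum_nonneg fun j _ =>
    hσnn i _ (hvmem j).1
  have hleM : ∀ i j, homForm (σ i) (v j) 1 ≤ M := fun i j =>
    (Finset.single_le_sum (f := fun j => homForm (σ i) (v j) 1)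
      (fun j _ => hσnn i _ (hvmem j).1) (Finset.mem_univ j)).trans
    (Finset.single_le_sum (f := fun i => ∑ j, homForm (σ i) (v j) 1)
      (fun i _ => Finset.sum_nonneg fun j _ => hσnn i _ (hvmem j).1) (Finset.mem_univ i))
  -- Dividing by `M + 1` keeps `h i` positive at all vertices; it is `1` at `v i` and smaller
  -- elsewhere on the polygon.
  set h : Fin n → ℝ × ℝ × ℝ := fun i =>
    (-(1 / (M + 1)) * (σ i).1, -(1 / (M + 1)) * (σ i).2.1, 1 - 1 / (M + 1) * (σ i).2.2) with hh
  have hform : ∀ i y, homForm (h i) y 1 = 1 - 1 / (M + 1) * homForm (σ i) y 1 := fun i y => by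
    simp only [homForm, hh]; ring
  have hδ : 0 < 1 / (M + 1) := by positivity
  have hone : ∀ i, homForm (h i) (v i) 1 = 1 := fun i => by rw [hform, hσv]; ring
  have hlt : ∀ i, ∀ q ∈ polygon S, q ≠ v i → homForm (h i) q 1 < 1 := fun i q hq hne => by
    have := mul_pos hδ (hσpos i q hq hne)
    rw [hform]; linarith
  obtain ⟨k, lam, hk, hlam, heq⟩ := exists_pos_mulVec_eq_one
    (fun i j => homForm (h j) (v i) 1) hone fun i j hij => by
      refine abs_lt.2 ⟨?_, hlt j _ (hvmem i).1 (hinj.ne hij)⟩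
      have : 1 / (M + 1) * homForm (σ j) (v i) 1 < 1 := by
        rw [one_div, inv_mul_lt_iff₀ (by positivity)]
        linarith [hleM j i]
      rw [hform]; linarith
  have hsc : StrictConvexOn ℝ Set.univ fun x : ℝ => x ^ (2 * k) :=
    (even_two_mul k).strictConvexOn_pow (by omega)
  have hconv : ∀ x y : ℝ × ℝ, ∀ a b : ℝ, 0 ≤ a → 0 ≤ b → a + b = 1 → ∀ j,
      lam j * homForm (h j) (a • x + b • y) 1 ^ (2 * k) ≤
        a * (lam j * homForm (h j) x 1 ^ (2 * k)) + b * (lam j * homForm (h j) y 1 ^ (2 * k)) := by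
    intro x y a b ha hb hab j
    have := mul_le_mul_of_nonneg_left (hsc.convexOn.2 (Set.mem_univ (homForm (h j) x 1))
      (Set.mem_univ (homForm (h j) y 1)) ha hb hab) (hlam j).le
    simp only [smul_eq_mul] at this
    rw [homForm_combo _ _ _ hab]
    linarith
  have hle : ∀ y ∈ polygon S, ∑ j, lam j * homForm (h j) y 1 ^ (2 * k) ≤ 1 := by
    refine polygon_subset_of_extremePoints_subset hcomp
      (C := {y | ∑ j, lam j * homForm (h j) y 1 ^ (2 * k) ≤ 1}) ?_ ?_ ?_
    · exact isClosed_le (continuous_finsetSum _ fun j _ =>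
        continuous_const.mul ((continuous_homForm _).pow _)) continuous_const
    · intro x hx y hy a b ha hb hab
      refine (Finset.sum_le_sum fun j _ => hconv x y a b ha hb hab j).trans ?_
      rw [Finset.sum_add_distrib, ← Finset.mul_sum, ← Finset.mul_sum]
      exact (add_le_add (mul_le_mul_of_nonneg_left hx ha)
        (mul_le_mul_of_nonneg_left hy hb)).trans (by linarith)
    · rw [← hrange]
      rintro _ ⟨i, rfl⟩
      exact (heq i).le
  refine ⟨n, h, lam, k, hk, hle, fun v' hv' q hq hne x hx => ?_⟩
  rw [← hrange] at hv'
  obtain ⟨i, rfl⟩ := hv'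
  obtain ⟨a, b, ha, hb, hab, hv⟩ := hx
  have hqi := hlt i q hq hne
  -- `h i` is not constant along the segment, so its power is strictly convex there.
  have hxq : homForm (h i) x 1 ≠ homForm (h i) q 1 := by
    intro he
    have := hone i
    rw [← hv, homForm_combo _ _ _ hab, he, ← add_mul, hab, one_mul] at this
    exact hqi.ne this
  have hstrict : ∑ j, lam j * homForm (h j) (v i) 1 ^ (2 * k) <
      ∑ j, (a * (lam j * homForm (h j) x 1 ^ (2 * k)) +
        b * (lam j * homForm (h j) q 1 ^ (2 * k))) := by
    refine Finset.sum_lt_sum (fun j _ => hv ▸ hconv x q a b ha.le hb.le hab j)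
      ⟨i, Finset.mem_univ i, ?_⟩
    have := mul_lt_mul_of_pos_left (hsc.2 (Set.mem_univ _) (Set.mem_univ _) hxq ha hb hab) (hlam i)
    simp only [smul_eq_mul] at this
    rw [← hv, homForm_combo _ _ _ hab]
    linarith
  rw [heq i, Finset.sum_add_distrib, ← Finset.mul_sum, ← Finset.mul_sum] at hstrict
  have h1 := mul_le_mul_of_nonneg_left (hle q hq) hb.le
  by_contra! hcon
  have h2 := mul_le_mul_of_nonneg_left hcon ha.le
  linarith

/-- **Bernig's theorem**: a convex polygon is described by two polynomial inequalities. -/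
theorem exists_two_inequalities {S : Finset (ℝ × ℝ × ℝ)} {R : ℝ}
    (hR : ∀ y ∈ polygon S, |y.1| ≤ R ∧ |y.2| ≤ R) (h0 : (0, 0) ∈ polygon S)
    (h1 : (1, 0) ∈ polygon S) (h2 : (0, 1) ∈ polygon S) :
    ∃ (T : Finset (ℝ × ℝ × ℝ)) (n : ℕ) (h : Fin n → ℝ × ℝ × ℝ) (lam : Fin n → ℝ) (k : ℕ),
      k ≠ 0 ∧ ∀ y, y ∈ polygon S ↔ 0 ≤ ∏ c ∈ T, homForm c y 1 ∧
        ∑ j, lam j * homForm (h j) y 1 ^ (2 * k) ≤ 1 := by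
  classical
  have hcomp := isCompact_polygon hR
  obtain ⟨T, hTS, hT⟩ := exists_irredundant S h0 h1 h2
  rw [← hTS] at hcomp ⊢
  obtain ⟨n, h, lam, k, hk, hle, hlt⟩ := exists_sum_pow_le_one hcomp
  refine ⟨T, n, h, lam, k, hk, fun y => ⟨fun hy => ⟨Finset.prod_nonneg hy, hle y hy⟩, ?_⟩⟩
  rintro ⟨hprod, hsum⟩
  by_contra hy
  obtain ⟨c₁, hc₁, hneg⟩ : ∃ c ∈ T, homForm c y 1 < 0 := by simpa [polygon] using hy
  obtain ⟨c₂, hc₂, hne, hnp⟩ : ∃ c ∈ T, c₁ ≠ c ∧ homForm c y 1 ≤ 0 := by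
    by_contra! hcon
    rw [← Finset.mul_prod_erase T _ hc₁] at hprod
    have : 0 < ∏ c ∈ T.erase c₁, homForm c y 1 := Finset.prod_pos fun c hc =>
      hcon c (Finset.mem_of_mem_erase hc) (Finset.ne_of_mem_erase hc).symm
    nlinarith
  obtain ⟨v, hv, q, hq, hqv, hseg⟩ :=
    exists_extremePoint_openSegment hT hcomp hc₁ hc₂ hne hneg hnp
  exact absurd hsum (not_le.2 (hlt v hv q hq hqv y hseg))

/-! ### Two inequalities are not enough in space -/

/-- A body in the upper half space that meets the plane `s = 0` in a polygon is not described by two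
polynomial inequalities. -/
theorem not_two_inequalities_of_slice {S : Finset (ℝ × ℝ × ℝ)} {R : ℝ}
    (hR : ∀ y ∈ polygon S, |y.1| ≤ R ∧ |y.2| ≤ R) (h0 : (0, 0) ∈ polygon S)
    (h1 : (1, 0) ∈ polygon S) (h2 : (0, 1) ∈ polygon S) (f g : MvPolynomial (Fin 3) ℝ)
    (hslice : ∀ y : ℝ × ℝ, y ∈ polygon S ↔
      0 ≤ MvPolynomial.eval ![y.1, y.2, 0] f ∧ 0 ≤ MvPolynomial.eval ![y.1, y.2, 0] g)
    (hpos : ∀ a b s : ℝ, 0 ≤ MvPolynomial.eval ![a, b, s] f →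
      0 ≤ MvPolynomial.eval ![a, b, s] g → 0 ≤ s) : False := by
  set φ : MvPolynomial (Fin 3) ℝ → MvPolynomial (Fin 2) ℝ := fun p =>
    MvPolynomial.aeval ![MvPolynomial.X 0, MvPolynomial.X 1, 0] p with hφ
  have hφe : ∀ p a b, MvPolynomial.eval ![a, b] (φ p) = MvPolynomial.eval ![a, b, 0] p := by
    intro p a b
    simp only [hφ]
    rw [MvPolynomial.aeval_def, MvPolynomial.hom_eval₂, ← MvPolynomial.eval₂_id]
    congr 1
    · ext; simp
    · funext i; fin_cases i <;> simp
  simp only [← hφe] at hslice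
  by_cases hf : φ f = 0
  · exact polygon_ne_nonneg_set hR h0 h1 h2 (φ g) fun y => by simp [hslice, hf]
  by_cases hg : φ g = 0
  · exact polygon_ne_nonneg_set hR h0 h1 h2 (φ f) fun y => by simp [hslice, hg]
  -- The box `(0, 1/2)²` lies in the unit triangle, hence in the polygon, and a nonzero polynomial
  -- cannot vanish on it.
  obtain ⟨x, hx, hne⟩ : ∃ x ∈ Set.univ.pi (fun _ : Fin 2 => Set.Ioo (0 : ℝ) (1 / 2)),
      MvPolynomial.eval x (φ f * φ g) ≠ 0 := by
    by_contra! hcon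
    exact mul_ne_zero hf hg (MvPolynomial.funext_set (fun _ => Set.Ioo (0 : ℝ) (1 / 2))
      (fun _ => Set.Ioo_infinite (by norm_num)) fun x hx => by rw [hcon x hx, map_zero])
  have hx0 := hx 0 trivial
  have hx1 := hx 1 trivial
  have hxe : x = ![x 0, x 1] := by funext i; fin_cases i <;> rfl
  have hmem : (x 0, x 1) ∈ polygon S := fun c hc => by
    have e0 := mul_nonneg (show 0 ≤ 1 - x 0 - x 1 by linarith [hx0.2, hx1.2]) (h0 c hc)
    have e1 := mul_nonneg hx0.1.le (h1 c hc)
    have e2 := mul_nonneg hx1.1.le (h2 c hc)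
    simp only [homForm] at *
    linarith
  have hfg := (hslice _).1 hmem
  rw [map_mul, hxe] at hne
  simp only [hφe] at hfg hne
  have hfpos := hfg.1.lt_of_ne' (left_ne_zero_of_mul hne)
  have hgpos := hfg.2.lt_of_ne' (right_ne_zero_of_mul hne)
  have hcont : ∀ p : MvPolynomial (Fin 3) ℝ,
      Continuous fun s : ℝ => MvPolynomial.eval ![x 0, x 1, s] p := fun p => by
    refine p.continuous_eval.comp (continuous_pi fun i => ?_)
    fin_cases i <;> simp <;> fun_prop
  have hev := (((hcont f).continuousAt.eventually_const_lt hfpos).and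
    ((hcont g).continuousAt.eventually_const_lt hgpos)).filter_mono
    (nhdsWithin_le_nhds (s := Set.Iio 0))
  obtain ⟨s, hs, hs0⟩ := (hev.and eventually_mem_nhdsWithin).exists
  exact absurd (hpos _ _ s hs.1.le hs.2.le) (not_le.2 hs0)

/-! ### Affine frames and transfer of polynomials -/

/-- The point with affine coordinates `(y, s)` in the frame with origin `o` and basis `b`. -/
noncomputable def framePoint (o : EuclideanSpace ℝ (Fin 3)) (b : Module.Basis (Fin 3) ℝ (EuclideanSpace ℝ (Fin 3)))
    (y : ℝ × ℝ) (s : ℝ) : EuclideanSpace ℝ (Fin 3) :=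
  o + y.1 • b 0 + y.2 • b 1 + s • b 2

section Frame

variable (o : EuclideanSpace ℝ (Fin 3)) (b : Module.Basis (Fin 3) ℝ (EuclideanSpace ℝ (Fin 3)))

theorem repr_framePoint (y : ℝ × ℝ) (s : ℝ) :
    b.repr (framePoint o b y s - o) 0 = y.1 ∧ b.repr (framePoint o b y s - o) 1 = y.2 ∧
      b.repr (framePoint o b y s - o) 2 = s := by
  have : framePoint o b y s - o = y.1 • b 0 + y.2 • b 1 + s • b 2 := by
    rw [framePoint]; abel
  rw [this]
  simp

theorem exists_eq_framePoint (x : EuclideanSpace ℝ (Fin 3)) : ∃ y s, x = framePoint o b y s := by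
  refine ⟨(b.repr (x - o) 0, b.repr (x - o) 1), b.repr (x - o) 2, ?_⟩
  have := b.sum_repr (x - o)
  rw [Fin.sum_univ_three] at this
  rw [framePoint, add_assoc, add_assoc, ← add_assoc (_ • b 0), this]
  abel

theorem framePoint_inj {y y' : ℝ × ℝ} {s s' : ℝ}
    (h : framePoint o b y s = framePoint o b y' s') : y = y' ∧ s = s' := by
  obtain ⟨h0, h1, h2⟩ := repr_framePoint o b y s
  obtain ⟨h0', h1', h2'⟩ := repr_framePoint o b y' s'
  rw [h] at h0 h1 h2
  exact ⟨Prod.ext (h0.symm.trans h0') (h1.symm.trans h1'), h2.symm.trans h2'⟩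

theorem exists_coordinate_polynomials : ∃ g : Fin 3 → MvPolynomial (Fin 3) ℝ, ∀ y s,
    MvPolynomial.eval (fun i => framePoint o b y s i) (g 0) = y.1 ∧
    MvPolynomial.eval (fun i => framePoint o b y s i) (g 1) = y.2 ∧
    MvPolynomial.eval (fun i => framePoint o b y s i) (g 2) = s := by
  refine ⟨fun i => ∑ j, MvPolynomial.C (b.repr (EuclideanSpace.basisFun (Fin 3) ℝ j) i) *
    (MvPolynomial.X j - MvPolynomial.C (o j)), fun y s => ?_⟩
  have key : ∀ (x : EuclideanSpace ℝ (Fin 3)) i, MvPolynomial.eval (fun i => x i)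
      (∑ j, MvPolynomial.C (b.repr (EuclideanSpace.basisFun (Fin 3) ℝ j) i) *
        (MvPolynomial.X j - MvPolynomial.C (o j))) = b.repr (x - o) i := by
    intro x i
    conv_rhs => rw [← (EuclideanSpace.basisFun (Fin 3) ℝ).sum_repr (x - o)]
    simp only [map_sum, map_mul, map_sub, MvPolynomial.eval_C, MvPolynomial.eval_X, map_smul,
      Finsupp.finsetSum_apply, Finsupp.smul_apply, smul_eq_mul]
    exact Finset.sum_congr rfl fun j _ => by simp [mul_comm]
  simp only [key]
  exact repr_framePoint o b y s

theorem exists_eval_framePoint (f : MvPolynomial (Fin 3) ℝ) : ∃ F : MvPolynomial (Fin 3) ℝ,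
    ∀ y s, MvPolynomial.eval ![y.1, y.2, s] F =
      MvPolynomial.eval (fun i => framePoint o b y s i) f := by
  refine ⟨MvPolynomial.aeval (fun j => MvPolynomial.C (o j) +
    MvPolynomial.X 0 * MvPolynomial.C (b 0 j) + MvPolynomial.X 1 * MvPolynomial.C (b 1 j) +
    MvPolynomial.X 2 * MvPolynomial.C (b 2 j)) f, fun y s => ?_⟩
  rw [MvPolynomial.aeval_def, MvPolynomial.hom_eval₂, ← MvPolynomial.eval₂_id]
  congr 1
  · ext; simp
  · funext i; simp [framePoint]

theorem three_le_of_isPolyRep {S : Finset (ℝ × ℝ × ℝ)} {R : ℝ}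
    (hR : ∀ y ∈ polygon S, |y.1| ≤ R ∧ |y.2| ≤ R) (h0 : (0, 0) ∈ polygon S)
    (h1 : (1, 0) ∈ polygon S) (h2 : (0, 1) ∈ polygon S) {P : Set (EuclideanSpace ℝ (Fin 3))}
    (hslice : ∀ y, framePoint o b y 0 ∈ P ↔ y ∈ polygon S)
    (hpos : ∀ y s, framePoint o b y s ∈ P → 0 ≤ s) {l : ℕ} {p : Fin l → MvPolynomial (Fin 3) ℝ}
    (hp : IsPolyRep P p) : 3 ≤ l := by
  by_contra! hl
  obtain ⟨f, g, hfg⟩ : ∃ f g : MvPolynomial (Fin 3) ℝ, ∀ x : EuclideanSpace ℝ (Fin 3), x ∈ P ↔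
      0 ≤ MvPolynomial.eval (fun i => x i) f ∧ 0 ≤ MvPolynomial.eval (fun i => x i) g := by
    have hp' : P = semialgSet p := hp
    subst hp'
    -- Shorter lists are padded with the constant polynomial `1`.
    interval_cases l
    · exact ⟨1, 1, fun x => by simp [semialgSet]⟩
    · exact ⟨p 0, 1, fun x => by simp [semialgSet]⟩
    · exact ⟨p 0, p 1, fun x => by simp [semialgSet, Fin.forall_fin_two]⟩
  obtain ⟨F, hF⟩ := exists_eval_framePoint o b f
  obtain ⟨G, hG⟩ := exists_eval_framePoint o b g
  refine not_two_inequalities_of_slice hR h0 h1 h2 F G (fun y => ?_) fun a c s hf hg => ?_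
  · rw [hF y 0, hG y 0, ← hfg, hslice]
  · rw [hF (a, c) s] at hf
    rw [hG (a, c) s] at hg
    exact hpos _ _ ((hfg _).2 ⟨hf, hg⟩)

/-- The polynomial `t` of the height serves both cases: the constant `1` for prisms, `1 - s` for
pyramids. -/
theorem exists_isPolyRep_three (T : Finset (ℝ × ℝ × ℝ)) {n : ℕ} (h : Fin n → ℝ × ℝ × ℝ)
    (lam : Fin n → ℝ) (k : ℕ) (t : Polynomial ℝ) (r : MvPolynomial (Fin 3) ℝ)
    {P : Set (EuclideanSpace ℝ (Fin 3))}
    (hP : ∀ y s, framePoint o b y s ∈ P ↔ 0 ≤ ∏ c ∈ T, homForm c y (t.eval s) ∧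
      ∑ j, lam j * homForm (h j) y (t.eval s) ^ (2 * k) ≤ t.eval s ^ (2 * k) ∧
      0 ≤ MvPolynomial.eval ![y.1, y.2, s] r) :
    ∃ p : Fin 3 → MvPolynomial (Fin 3) ℝ, IsPolyRep P p := by
  obtain ⟨g, hg⟩ := exists_coordinate_polynomials o b
  set τ : MvPolynomial (Fin 3) ℝ := Polynomial.aeval (g 2) t with hτ
  have hτe : ∀ y s, MvPolynomial.eval (fun i => framePoint o b y s i) τ = t.eval s := by
    intro y s
    rw [hτ, Polynomial.aeval_def, Polynomial.hom_eval₂, (hg y s).2.2, Polynomial.eval,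
      show (MvPolynomial.eval fun i => framePoint o b y s i).comp
        (algebraMap ℝ (MvPolynomial (Fin 3) ℝ)) = RingHom.id ℝ by ext; simp]
  set form : ℝ × ℝ × ℝ → MvPolynomial (Fin 3) ℝ := fun c =>
    MvPolynomial.C c.1 * g 0 + MvPolynomial.C c.2.1 * g 1 + MvPolynomial.C c.2.2 * τ with hform
  have hforme : ∀ c y s, MvPolynomial.eval (fun i => framePoint o b y s i) (form c) =
      homForm c y (t.eval s) := by
    intro c y s
    simp [hform, hτe, (hg y s).1, (hg y s).2.1, homForm]
  have hr : ∀ y s, MvPolynomial.eval (fun i => framePoint o b y s i) (MvPolynomial.aeval g r) =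
      MvPolynomial.eval ![y.1, y.2, s] r := by
    intro y s
    rw [MvPolynomial.aeval_def, MvPolynomial.hom_eval₂, ← MvPolynomial.eval₂_id]
    congr 1
    · ext; simp
    · funext i
      fin_cases i
      exacts [(hg y s).1, (hg y s).2.1, (hg y s).2.2]
  refine ⟨![∏ c ∈ T, form c, τ ^ (2 * k) - ∑ j, MvPolynomial.C (lam j) * form (h j) ^ (2 * k),
    MvPolynomial.aeval g r], Set.ext fun x => ?_⟩
  obtain ⟨y, s, rfl⟩ := exists_eq_framePoint o b x
  rw [hP]
  simp only [semialgSet, Set.mem_ofPred_eq, Fin.forall_fin_succ, Matrix.cons_val_zero,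
    Matrix.cons_val_succ, map_prod, map_sub, map_pow, map_sum, map_mul, MvPolynomial.eval_C,
    hforme, hτe, hr, sub_nonneg, IsEmpty.forall_iff, and_true]

end Frame

/-! ### The truncated cone over a polygon -/

theorem mem_cone_polygon_iff {S T : Finset (ℝ × ℝ × ℝ)} {R : ℝ}
    (hR : ∀ y ∈ polygon S, |y.1| ≤ R ∧ |y.2| ≤ R) (h0 : (0, 0) ∈ polygon S)
    (h1 : (1, 0) ∈ polygon S) {n : ℕ} {h : Fin n → ℝ × ℝ × ℝ} {lam : Fin n → ℝ} {k : ℕ}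
    (hk : k ≠ 0) (hS : ∀ y, y ∈ polygon S ↔ 0 ≤ ∏ c ∈ T, homForm c y 1 ∧
        ∑ j, lam j * homForm (h j) y 1 ^ (2 * k) ≤ 1) (y : ℝ × ℝ) (t : ℝ) :
    (0 ≤ t ∧ t ≤ 1 ∧ ∃ z ∈ polygon S, y = t • z) ↔ 0 ≤ ∏ c ∈ T, homForm c y t ∧
      ∑ j, lam j * homForm (h j) y t ^ (2 * k) ≤ t ^ (2 * k) ∧
      0 ≤ (1 - t) * (2 * R ^ 2 * (t + t ^ 3) - y.1 ^ 2 - y.2 ^ 2) := by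
  have hR1 : 1 ≤ R := by simpa using (hR _ h1).1
  have h2k : 2 * k ≠ 0 := by omega
  rcases lt_trichotomy t 0 with ht | rfl | ht
  · refine ⟨fun hh => absurd hh.1 (not_le.2 ht), fun hh => ?_⟩
    have hb : 2 * R ^ 2 * (t + t ^ 3) < 0 := by
      have : t + t ^ 3 < 0 := by nlinarith [sq_nonneg t]
      exact mul_neg_of_pos_of_neg (by positivity) this
    have : (1 - t) * (2 * R ^ 2 * (t + t ^ 3) - y.1 ^ 2 - y.2 ^ 2) < 0 :=
      mul_neg_of_pos_of_neg (by linarith) (by nlinarith [sq_nonneg y.1, sq_nonneg y.2])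
    linarith [hh.2.2]
  · have hz : ∀ c, homForm c (0 : ℝ × ℝ) 0 = 0 := fun c => by simp [homForm]
    constructor
    · rintro ⟨-, -, z, -, rfl⟩
      rw [zero_smul]
      exact ⟨Finset.prod_nonneg fun c _ => (hz c).ge, by simp [hz, h2k], by simp⟩
    · rintro ⟨-, -, hh⟩
      have e1 : y.1 = 0 := by nlinarith [sq_nonneg y.1, sq_nonneg y.2]
      have e2 : y.2 = 0 := by nlinarith [sq_nonneg y.1, sq_nonneg y.2]
      exact ⟨le_rfl, zero_le_one, (0, 0), h0, by ext <;> simp [e1, e2]⟩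
  · have hsc : ∀ c, homForm c y t = t * homForm c (t⁻¹ • y) 1 := fun c => by
      rw [← homForm_smul, smul_inv_smul₀ ht.ne', mul_one]
    have hmem : t⁻¹ • y ∈ polygon S ↔ 0 ≤ ∏ c ∈ T, homForm c y t ∧
        ∑ j, lam j * homForm (h j) y t ^ (2 * k) ≤ t ^ (2 * k) := by
      have hp : 0 < t ^ T.card := pow_pos ht _
      have hq : 0 < t ^ (2 * k) := pow_pos ht _
      have hsum : ∑ j, lam j * homForm (h j) y t ^ (2 * k) =
          t ^ (2 * k) * ∑ j, lam j * homForm (h j) (t⁻¹ • y) 1 ^ (2 * k) := by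
        rw [Finset.mul_sum]
        exact Finset.sum_congr rfl fun j _ => by rw [hsc, mul_pow]; ring
      rw [hS, hsum, Finset.prod_congr rfl fun c _ => hsc c, Finset.prod_mul_distrib,
        Finset.prod_const, mul_nonneg_iff_of_pos_left hp, mul_le_iff_le_one_right hq]
    have hleft : (∃ z ∈ polygon S, y = t • z) ↔ t⁻¹ • y ∈ polygon S := by
      constructor
      · rintro ⟨z, hz, rfl⟩
        rwa [inv_smul_smul₀ ht.ne']
      · exact fun hy => ⟨_, hy, (smul_inv_smul₀ ht.ne' y).symm⟩
    rw [hleft, ← and_assoc (a := 0 ≤ ∏ c ∈ T, _), ← hmem]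
    have hbr : t⁻¹ • y ∈ polygon S → 0 < 2 * R ^ 2 * (t + t ^ 3) - y.1 ^ 2 - y.2 ^ 2 := by
      intro hy
      obtain ⟨a1, a2⟩ := hR _ hy
      simp only [Prod.smul_fst, Prod.smul_snd, smul_eq_mul, abs_mul, abs_inv, abs_of_pos ht,
        inv_mul_le_iff₀ ht] at a1 a2
      have b1 := pow_le_pow_left₀ (abs_nonneg _) a1 2
      have b2 := pow_le_pow_left₀ (abs_nonneg _) a2 2
      rw [sq_abs, mul_pow] at b1 b2
      have : 0 < R ^ 2 * (t * (t ^ 2 + 1 - t)) :=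
        mul_pos (by positivity) (mul_pos ht (by nlinarith [sq_nonneg (t - 1)]))
      nlinarith
    constructor
    · rintro ⟨-, ht1, hy⟩
      exact ⟨hy, mul_nonneg (by linarith) (hbr hy).le⟩
    · rintro ⟨hy, hh⟩
      exact ⟨ht.le, by linarith [(mul_nonneg_iff_of_pos_right (hbr hy)).1 hh], hy⟩

/-! ### Frames adapted to the base -/

/-- A basis of the direction space can be chosen among the differences `q - o`; thus the unit
triangle in these coordinates has its corners in `Q`. -/
theorem exists_frame {Q : Set (EuclideanSpace ℝ (Fin 3))} (hQ : IsPolytopeOfDim 2 Q) :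
    ∃ o u w, o ∈ Q ∧ o + u ∈ Q ∧ o + w ∈ Q ∧ ∀ q ∈ Q, ∃ y : ℝ × ℝ, q = o + y.1 • u + y.2 • w := by
  obtain ⟨-, -, ⟨o, ho⟩, hdim⟩ := hQ
  rw [direction_affineSpan, vectorSpan_eq_span_vsub_set_right ℝ ho] at hdim
  have hex := Submodule.exists_fun_fin_finrank_span_eq ℝ ((· -ᵥ o) '' Q)
  rw [hdim] at hex
  obtain ⟨f, hf, hspan, -⟩ := hex
  have hmem : ∀ i, o + f i ∈ Q := fun i => by
    obtain ⟨q, hq, hqi⟩ := hf i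
    rw [← hqi]
    simpa using hq
  refine ⟨o, f 0, f 1, ho, hmem 0, hmem 1, fun q hq => ?_⟩
  have hq' : q - o ∈ Submodule.span ℝ (Set.range f) :=
    hspan ▸ Submodule.subset_span ⟨q, hq, rfl⟩
  obtain ⟨c, hc⟩ := (Submodule.mem_span_range_iff_exists_fun ℝ).1 hq'
  rw [Fin.sum_univ_two] at hc
  exact ⟨(c 0, c 1), by rw [add_assoc, hc]; abel⟩

theorem exists_basis_of_frame {P : Set (EuclideanSpace ℝ (Fin 3))}
    (hP : Module.finrank ℝ (affineSpan ℝ P).direction = 3) {o u w v : EuclideanSpace ℝ (Fin 3)}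
    (h : ∀ x ∈ P, ∃ α β γ : ℝ, x = o + α • u + β • w + γ • v) :
    ∃ b : Module.Basis (Fin 3) ℝ (EuclideanSpace ℝ (Fin 3)), b 0 = u ∧ b 1 = w ∧ b 2 = v := by
  set W := Submodule.span ℝ (Set.range ![u, w, v]) with hW
  have hle : affineSpan ℝ P ≤ AffineSubspace.mk' o W := by
    rw [affineSpan_le]
    intro x hx
    obtain ⟨α, β, γ, rfl⟩ := h x hx
    have hmem : ∀ i, ![u, w, v] i ∈ W := fun i => Submodule.subset_span (Set.mem_range_self i)
    rw [SetLike.mem_coe, AffineSubspace.mem_mk', vsub_eq_sub,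
      show o + α • u + β • w + γ • v - o = α • u + β • w + γ • v by abel]
    exact W.add_mem (W.add_mem (W.smul_mem _ (hmem 0)) (W.smul_mem _ (hmem 1)))
      (W.smul_mem _ (hmem 2))
  have htop : (affineSpan ℝ P).direction = ⊤ :=
    Submodule.eq_top_of_finrank_eq (by rw [hP, finrank_euclideanSpace_fin])
  have hWtop : ⊤ ≤ W := by
    rw [← htop, ← AffineSubspace.direction_mk' o W]
    exact AffineSubspace.direction_le hle
  refine ⟨basisOfTopLeSpanOfCardEqFinrank ![u, w, v] hWtop (by simp), ?_⟩
  simp [coe_basisOfTopLeSpanOfCardEqFinrank]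

theorem exists_polygon_of_isPolyhedron (o : EuclideanSpace ℝ (Fin 3))
    (b : Module.Basis (Fin 3) ℝ (EuclideanSpace ℝ (Fin 3))) {Q : Set (EuclideanSpace ℝ (Fin 3))}
    (hQ : IsPolyhedron Q) : ∃ S, ∀ y, framePoint o b y 0 ∈ Q ↔ y ∈ polygon S := by
  classical
  obtain ⟨m, a, β, rfl⟩ := hQ
  refine ⟨Finset.univ.image fun i => (-inner ℝ (a i) (b 0), -inner ℝ (a i) (b 1),
    β i - inner ℝ (a i) o), fun y => ?_⟩
  simp only [polygon, homForm, framePoint, Set.mem_ofPred_eq, Finset.mem_image, Finset.mem_univ,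
    true_and, forall_exists_index, forall_apply_eq_imp_iff, inner_add_right, inner_smul_right]
  refine forall_congr' fun i => ?_
  constructor <;> intro h <;> linarith

theorem exists_bound_of_isBounded (o : EuclideanSpace ℝ (Fin 3))
    (b : Module.Basis (Fin 3) ℝ (EuclideanSpace ℝ (Fin 3))) {Q : Set (EuclideanSpace ℝ (Fin 3))}
    (hQ : Bornology.IsBounded Q) :
    ∃ R : ℝ, ∀ y, framePoint o b y 0 ∈ Q → |y.1| ≤ R ∧ |y.2| ≤ R := by
  obtain ⟨r, hr⟩ := hQ.subset_closedBall o
  have hcoord : ∀ i, ∃ C : ℝ, ∀ x ∈ Q, |b.repr (x - o) i| ≤ C := by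
    intro i
    refine ⟨‖(b.coord i).toContinuousLinearMap‖ * r, fun x hx => ?_⟩
    have h1 := (b.coord i).toContinuousLinearMap.le_opNorm (x - o)
    have h2 : ‖x - o‖ ≤ r := by simpa [dist_eq_norm] using hr hx
    exact h1.trans (mul_le_mul_of_nonneg_left h2 (norm_nonneg _))
  obtain ⟨C, hC⟩ := hcoord 0
  obtain ⟨C', hC'⟩ := hcoord 1
  refine ⟨max C C', fun y hy => ?_⟩
  obtain ⟨e0, e1, -⟩ := repr_framePoint o b y 0
  have i0 := hC _ hy
  have i1 := hC' _ hy
  rw [e0] at i0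
  rw [e1] at i1
  exact ⟨i0.trans (le_max_left _ _), i1.trans (le_max_right _ _)⟩

theorem minPolyNum_eq_three_of_exists {P : Set (EuclideanSpace ℝ (Fin 3))}
    (hex : ∃ p : Fin 3 → MvPolynomial (Fin 3) ℝ, IsPolyRep P p)
    (hmin : ∀ (l : ℕ) (p : Fin l → MvPolynomial (Fin 3) ℝ), IsPolyRep P p → 3 ≤ l) :
    minPolyNum P = 3 :=
  le_antisymm (Nat.sInf_le hex) (le_csInf ⟨3, hex⟩ fun l ⟨p, hp⟩ => hmin l p hp)

/-! ### Prisms and pyramids -/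

theorem minPolyNum_prism {P : Set (EuclideanSpace ℝ (Fin 3))} (hP : IsPrism P) :
    minPolyNum P = 3 := by
  obtain ⟨⟨-, -, -, hdim⟩, k, Q, v, hk, hQ, hPQ⟩ := hP
  obtain rfl : k = 2 := by omega
  obtain ⟨o, u, w, ho, hu, hw, hspan⟩ := exists_frame hQ
  have hmem : ∀ x, x ∈ P ↔ ∃ q ∈ Q, ∃ s : ℝ, 0 ≤ s ∧ s ≤ 1 ∧ x = q + s • v := by
    intro x
    rw [hPQ, convexHull_pair, segment_eq_image]
    simp only [Set.mem_add, Set.mem_image, Set.mem_Icc, smul_zero, zero_add]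
    constructor
    · rintro ⟨q, hq, _, ⟨s, hs, rfl⟩, rfl⟩
      exact ⟨q, hq, s, hs.1, hs.2, rfl⟩
    · rintro ⟨q, hq, s, hs0, hs1, rfl⟩
      exact ⟨q, hq, _, ⟨s, ⟨hs0, hs1⟩, rfl⟩, rfl⟩
  obtain ⟨b, rfl, rfl, rfl⟩ := exists_basis_of_frame (v := v) hdim fun x hx => by
    obtain ⟨q, hq, s, -, -, rfl⟩ := (hmem x).1 hx
    obtain ⟨y, rfl⟩ := hspan q hq
    exact ⟨_, _, s, rfl⟩
  obtain ⟨S, hS⟩ := exists_polygon_of_isPolyhedron o b hQ.1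
  obtain ⟨R, hR⟩ := exists_bound_of_isBounded o b hQ.2.1
  simp only [hS] at hR
  have h0 : (0, 0) ∈ polygon S := (hS _).1 (by simpa [framePoint] using ho)
  have h1 : (1, 0) ∈ polygon S := (hS _).1 (by simpa [framePoint] using hu)
  have h2 : (0, 1) ∈ polygon S := (hS _).1 (by simpa [framePoint] using hw)
  have hcoord : ∀ y s, framePoint o b y s ∈ P ↔ y ∈ polygon S ∧ 0 ≤ s ∧ s ≤ 1 := by
    intro y s
    rw [hmem]
    constructor
    · rintro ⟨q, hq, s', hs0, hs1, heq⟩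
      obtain ⟨z, hz⟩ := hspan q hq
      have hq' : q = framePoint o b z 0 := by simp [hz, framePoint]
      obtain ⟨rfl, rfl⟩ := framePoint_inj o b (y' := z) (s' := s') (by rw [heq, hz, framePoint])
      exact ⟨(hS _).1 (hq' ▸ hq), hs0, hs1⟩
    · rintro ⟨hy, hs0, hs1⟩
      exact ⟨_, (hS y).2 hy, s, hs0, hs1, by simp [framePoint]⟩
  obtain ⟨T, n, h, lam, k, hk0, hT⟩ := exists_two_inequalities hR h0 h1 h2
  refine minPolyNum_eq_three_of_exists
    (exists_isPolyRep_three o b T h lam k 1 (MvPolynomial.X 2 * (1 - MvPolynomial.X 2)) ?_)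
    fun l p => three_le_of_isPolyRep o b hR h0 h1 h2 (by simp [hcoord])
      fun y s hys => ((hcoord y s).1 hys).2.1
  intro y s
  rw [hcoord, hT, and_assoc]
  simp only [Polynomial.eval_one, one_pow, map_mul, map_sub, map_one, MvPolynomial.eval_X,
    Matrix.cons_val]
  refine and_congr_right fun _ => and_congr_right fun _ => ⟨fun hs => ?_, fun hs => ?_⟩
  · exact mul_nonneg hs.1 (by linarith [hs.2])
  · constructor <;> nlinarith

theorem minPolyNum_pyramid {P : Set (EuclideanSpace ℝ (Fin 3))} (hP : IsPyramid P) :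
    minPolyNum P = 3 := by
  obtain ⟨⟨-, -, -, hdim⟩, k, Q, v, hk, hQ, hPQ⟩ := hP
  obtain rfl : k = 2 := by omega
  obtain ⟨o, u, w, ho, hu, hw, hspan⟩ := exists_frame hQ
  have hconv : Convex ℝ Q := by
    obtain ⟨m, a, β, rfl⟩ := hQ.1
    rw [Set.ofPred_forall]
    exact convex_iInter fun i => convex_halfSpace_le (innerₛₗ ℝ (a i)).isLinear (β i)
  -- The third frame vector joins the base point `o` to the apex, so the base has height `0` and the
  -- apex height `1`.
  obtain ⟨e, rfl⟩ : ∃ e, v = o + e := ⟨v - o, by abel⟩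
  have hmem : ∀ x, x ∈ P ↔ ∃ q ∈ Q, ∃ s : ℝ, 0 ≤ s ∧ s ≤ 1 ∧ x = (1 - s) • q + s • (o + e) := by
    intro x
    rw [hPQ, Set.union_singleton, convexHull_insert ⟨o, ho⟩, hconv.convexHull_eq, mem_convexJoin]
    simp only [Set.mem_singleton_iff, exists_eq_left]
    refine exists_congr fun q => and_congr_right fun _ => ?_
    rw [segment_symm, segment_eq_image]
    constructor
    · rintro ⟨s, hs, rfl⟩
      exact ⟨s, hs.1, hs.2, rfl⟩
    · rintro ⟨s, hs0, hs1, rfl⟩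
      exact ⟨s, ⟨hs0, hs1⟩, rfl⟩
  obtain ⟨b, rfl, rfl, rfl⟩ := exists_basis_of_frame (o := o) (u := u) (w := w) (v := e) hdim
    fun x hx => by
      obtain ⟨q, hq, s, -, -, rfl⟩ := (hmem x).1 hx
      obtain ⟨y, rfl⟩ := hspan q hq
      exact ⟨(1 - s) * y.1, (1 - s) * y.2, s, by module⟩
  obtain ⟨S, hS⟩ := exists_polygon_of_isPolyhedron o b hQ.1
  obtain ⟨R, hR⟩ := exists_bound_of_isBounded o b hQ.2.1
  simp only [hS] at hR
  have h0 : (0, 0) ∈ polygon S := (hS _).1 (by simpa [framePoint] using ho)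
  have h1 : (1, 0) ∈ polygon S := (hS _).1 (by simpa [framePoint] using hu)
  have h2 : (0, 1) ∈ polygon S := (hS _).1 (by simpa [framePoint] using hw)
  have hcoord : ∀ y s, framePoint o b y s ∈ P ↔
      0 ≤ 1 - s ∧ 1 - s ≤ 1 ∧ ∃ z ∈ polygon S, y = (1 - s) • z := by
    intro y s
    have hcomb : ∀ (z : ℝ × ℝ) (r : ℝ), (1 - r) • framePoint o b z 0 + r • (o + b 2) =
        framePoint o b ((1 - r) • z) r := by
      intro z r
      simp only [framePoint, Prod.smul_fst, Prod.smul_snd, smul_eq_mul]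
      module
    rw [hmem]
    constructor
    · rintro ⟨q, hq, s', hs0, hs1, heq⟩
      obtain ⟨z, hz⟩ := hspan q hq
      obtain rfl : q = framePoint o b z 0 := by simp [hz, framePoint]
      rw [hcomb] at heq
      obtain ⟨rfl, rfl⟩ := framePoint_inj o b heq
      exact ⟨by linarith, by linarith, z, (hS _).1 hq, rfl⟩
    · rintro ⟨hs1, hs0, z, hz, rfl⟩
      exact ⟨_, (hS z).2 hz, s, by linarith, by linarith, (hcomb z s).symm⟩
  obtain ⟨T, n, h, lam, k, hk0, hT⟩ := exists_two_inequalities hR h0 h1 h2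
  refine minPolyNum_eq_three_of_exists
    (exists_isPolyRep_three o b T h lam k (1 - Polynomial.X) (MvPolynomial.X 2 *
      (MvPolynomial.C (2 * R ^ 2) * ((1 - MvPolynomial.X 2) + (1 - MvPolynomial.X 2) ^ 3) -
        MvPolynomial.X 0 ^ 2 - MvPolynomial.X 1 ^ 2)) ?_)
    fun l p => three_le_of_isPolyRep o b hR h0 h1 h2 (by simp [hcoord])
      fun y s hys => by linarith [((hcoord y s).1 hys).2.1]
  intro y s
  rw [hcoord, mem_cone_polygon_iff hR h0 h1 hk0 hT]
  simp only [Polynomial.eval_sub, Polynomial.eval_one, Polynomial.eval_X, map_mul, map_sub,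
    map_add, map_pow, map_one, MvPolynomial.eval_X, MvPolynomial.eval_C, Matrix.cons_val,
    sub_sub_cancel]

theorem corollary2p4 (P : Set (EuclideanSpace ℝ (Fin 3))) (hP : IsPrism P ∨ IsPyramid P) :
    minPolyNum P = 3 := by
  exact hP.elim minPolyNum_prism minPolyNum_pyramid
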